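/- **Setting.** Let $G=(V,E)$ be a finite nonempty simple undirected graph with maximum degree $\Delta$, let $q\ge 2$ be an integer and $\beta\ge 0$. On the set $X=\{1,\dots,q\}^V$ of colorings put, with $E(x)=\{\{u,v\}\in E: x_u=x_v\}$, the Gibbs distribution of the $q$-state Potts model $$P(x)=\frac{1}{Z}\,e^{\beta |E(x)|},\qquad Z=\sum_{x\in X}e^{\beta|E(x)|}.$$ The heat-bath kernel picks a vertex uniformly at random and resamples its color from the conditional distribution given the other colors: $$K^{\rm HB}(x'|x)=\frac1{|V|}\sum_{v\in V}P(x'_v\,|\,x^{\setminus v})\,\mathbf 1\{(x')^{\setminus v}=x^{\setminus v}\}.$$ Let $M(x,A)=\frac1Z(e^\beta-1)^{|A|}\mathbf 1\{A\subseteq E(x)\}$ for $x\in X$, $A\subseteq E$ (with $0^0=1$). The Swendsen–Wang kernel is $$K^{\rm SW}(x'|x)=\sum_{A\subseteq E}M(x'|A)\,M(A|x),$$ where $M(\cdot|A)$ and $M(\cdot|x)$ are the conditional distributions under $M$. For a convex function $\Phi:[0,\infty)\to\mathbb R$ and a nonnegative integrable random variable $U$ with $\mathbb E|\Phi(U)|<\infty$,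 let $\mathrm{Ent}_\Phi[U]=\mathbb E[\Phi(U)]-\Phi(\mathbb E[U])$. The function $\Phi$ is *homogeneous* if there is $\kappa:(0,\infty)\to(0,\infty)$ such that $\mathrm{Ent}_\Phi[cU]=\kappa(c)\,\mathrm{Ent}_\Phi[U]$ (in particular, $\mathrm{Ent}_\Phi[cU]$ is defined) for all such $U$ and all $c>0$. For probability distributions $\nu,\mu$ on a finite set with $\mu$ strictly positive, let $D_\Phi(\nu\|\mu)=\sum_x\mu(x)\Phi(\nu(x)/\mu(x))-\Phi(1)$, and for a Markov kernel $K$ with $\mu K$ strictly positive let $$\eta_\Phi(\mu,K)=\sup_{\nu\ne\mu}\frac{D_\Phi(\nu K\|\mu K)}{D_\Phi(\nu\|\mu)}\in[0,1]$$ (the ratio is read as $0$ if $D_\Phi(\nu\|\mu)=0$, in which case its numerator vanishes as well). Put $C=q^{2\Delta+1}e^{4\beta\Delta}$. **Theorem.** For every convex $\Phi:[0,\infty)\to\mathbb R$ that is homogeneous, $$\eta_\Phi(P,K^{\rm SW})\le\frac{q^{2\Delta+1}e^{4\beta\Delta}-1}{q^{2\Delta+1}e^{4\beta\Delta}-\eta_\Phi(P,K^{\rm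 HB})^2}.$$ For $\Phi(u)=(u-1)^2$ this sharpens Ullrich's bound $\sqrt{\eta_{\chi^2}(P,K^{\rm SW})}\le\frac{2C^2-1+\sqrt{\eta_{\chi^2}(P,K^{\rm HB})}}{2C^2}$: with $h=\eta_{\chi^2}(P,K^{\rm HB})$, $$\sqrt{\frac{C-1}{C-h^2}}\le\frac{2C^2-1+\sqrt h}{2C^2},$$ with strict inequality if $h<1$. -/

import Mathlib

open MeasureTheory

noncomputable section

namespace SDPI

/-- The class of generating functions: convex functions `Φ : [0, ∞) → ℝ`
(a function on `ℝ` of which only the values on `[0, ∞)` are used). -/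
def IsGenerating (Φ : ℝ → ℝ) : Prop :=
  ConvexOn ℝ (Set.Ici 0) Φ

/-- The `Φ`-entropy `E[Φ(U)] - Φ(E[U])` of a nonnegative random variable `U`
(used only when `U` and `Φ(U)` are integrable). -/
def ent (Φ : ℝ → ℝ) {Ω : Type} [MeasurableSpace Ω] (P : Measure Ω) (U : Ω → ℝ) : ℝ :=
  (∫ ω, Φ (U ω) ∂P) - Φ (∫ ω, U ω ∂P)

/-- The homogeneity condition: for some `κ : (0, ∞) → (0, ∞)`, one has
`Ent[c U] = κ(c) Ent[U]` for every nonnegative random variable `U` of finite `Φ`-entropy and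
every `c > 0`; in particular `c U` has finite `Φ`-entropy too. -/
def IsHomogeneous (Φ : ℝ → ℝ) : Prop :=
  ∃ κ : ℝ → ℝ, (∀ c, 0 < c → 0 < κ c) ∧
    ∀ (Ω : Type) [MeasurableSpace Ω] (P : Measure Ω) [IsProbabilityMeasure P] (U : Ω → ℝ),
      Measurable U → (∀ ω, 0 ≤ U ω) → Integrable U P → Integrable (fun ω => Φ (U ω)) P →
      ∀ c : ℝ, 0 < c →
        Integrable (fun ω => Φ (c * U ω)) P ∧
          ent Φ P (fun ω => c * U ω) = κ c * ent Φ P U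

/-- The output distribution `μK(y) = ∑ x, μ(x) K(y|x)`.  Kernels between finite alphabets are
written `K x y` for `K(y|x)`. -/
def push {X Y : Type*} [Fintype X] (μ : X → ℝ) (K : X → Y → ℝ) (y : Y) : ℝ :=
  ∑ x, μ x * K x y

/-- The `Φ`-divergence `E_μ[Φ(dν/dμ)] - Φ(1)`, for strictly positive `μ`. -/
def phiDiv {X : Type*} [Fintype X] (Φ : ℝ → ℝ) (ν μ : X → ℝ) : ℝ :=
  (∑ x, μ x * Φ (ν x / μ x)) - Φ 1

/-- The SDPI constant: the supremum of `D_Φ(νK‖μK) / D_Φ(ν‖μ)` over probability distributions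
`ν ≠ μ`.  By the data processing inequality the ratios lie in `[0, 1]`; where `D_Φ(ν‖μ) = 0` the
numerator vanishes too, and the ratio is read as `0`. -/
def eta {X Y : Type*} [Fintype X] [Fintype Y] (Φ : ℝ → ℝ) (μ : X → ℝ) (K : X → Y → ℝ) : ℝ :=
  sSup {r : ℝ | ∃ ν ∈ stdSimplex ℝ X, ν ≠ μ ∧
    r = phiDiv Φ (push ν K) (push μ K) / phiDiv Φ ν μ}

section Potts

variable {V : Type*} [Fintype V] [DecidableEq V] (G : SimpleGraph V) [DecidableRel G.Adj]
  (q : ℕ) (β : ℝ)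

/-- `E(x)`: the set of edges of `G` whose two endpoints have the same color under `x`. -/
def monoEdges (x : V → Fin q) : Finset (Sym2 V) :=
  G.edgeFinset.filter fun e => (e.map x).IsDiag

/-- The partition function of the `q`-state Potts model. -/
def partitionFn : ℝ :=
  ∑ x : V → Fin q, Real.exp (β * ((monoEdges G q x).card : ℝ))

/-- The Gibbs distribution of the `q`-state Potts model at inverse temperature `β`. -/
def gibbs (x : V → Fin q) : ℝ :=
  Real.exp (β * ((monoEdges G q x).card : ℝ)) / partitionFn G q β

/-- The conditional probability, under the Gibbs distribution, that the vertex `v` has color `c`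
given that all other vertices are colored as in `x`. -/
def gibbsCond (v : V) (c : Fin q) (x : V → Fin q) : ℝ :=
  gibbs G q β (Function.update x v c) / ∑ c' : Fin q, gibbs G q β (Function.update x v c')

/-- The heat-bath kernel: `kernelHB G q β x x'` is the transition probability from `x` to `x'`. -/
def kernelHB (x x' : V → Fin q) : ℝ :=
  (1 / (Fintype.card V : ℝ)) *
    ∑ v : V, gibbsCond G q β v (x' v) x * (if ∀ u, u ≠ v → x' u = x u then 1 else 0)

/-- The coupling `M(x, A) = (e^β - 1)^|A| 1{A ⊆ E(x)} / Z` of the Potts model and the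
random-cluster model, on pairs of a coloring `x` and a set `A` of edges. -/
def coupling (x : V → Fin q) (A : Finset (Sym2 V)) : ℝ :=
  (if A ⊆ monoEdges G q x then (Real.exp β - 1) ^ A.card else 0) / partitionFn G q β

/-- The conditional distribution of the edge set given the coloring, under the coupling. -/
def edgesGivenColoring (x : V → Fin q) (A : Finset (Sym2 V)) : ℝ :=
  coupling G q β x A / ∑ B ∈ G.edgeFinset.powerset, coupling G q β x B

/-- The conditional distribution of the coloring given the edge set, under the coupling
(used only on edge sets of positive probability). -/
def coloringGivenEdges (A : Finset (Sym2 V)) (x : V → Fin q) : ℝ :=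
  coupling G q β x A / ∑ y : V → Fin q, coupling G q β y A

/-- The Swendsen–Wang kernel: `kernelSW G q β x x'` is the transition probability from `x` to
`x'`; draw an edge set given `x`, then `x'` given the edge set. -/
def kernelSW (x x' : V → Fin q) : ℝ :=
  ∑ A ∈ G.edgeFinset.powerset, coloringGivenEdges G q β A x' * edgesGivenColoring G q β x A

/-- The constant `q^(2Δ+1) e^(4βΔ)`, where `Δ` is the maximum degree of `G`. -/
def comparisonConst : ℝ :=
  (q : ℝ) ^ (2 * G.maxDegree + 1) * Real.exp (4 * β * (G.maxDegree : ℝ))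

end Potts

end SDPI

end

set_option linter.unusedSectionVars false

/-! Write `H` for the heat-bath kernel, `S` for Swendsen–Wang, and `C` for `comparisonConst`. The
core is the pointwise bound `H S H ≤ C S` (`kernelHB_kernelSW_kernelHB_le`). It makes `R = (C S - H
S H) / (C - 1)` a Markov kernel fixing the Gibbs distribution, so `S` is the mixture of `H S H` and
`R` with weights `1/C` and `1 - 1/C`. Convexity of the divergence in its first argument, data
processing for `R`, and contraction through `H`, `S`, `H` in turn give `η(S) ≤ η(H)² η(S) / C + 1 -
1/C`. Solving for `η(S)` is the theorem (`eta_le_of_sandwich_le`).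

For the pointwise bound, `S(x, y)` equals `e^(-β|E(x)|)` times the sum of `(e^β - 1)^|A| / n(A)`
over `A ⊆ E(x) ∩ E(y)`, with `n(A)` the number of colorings constant along the edges of `A`
(`kernelSW_eq`). Recoloring one vertex in each argument affects only the edges of two stars, at most
`2Δ` in all. Adding an edge to `A` divides `n(A)` by at most `q`, so `S` changes by a bounded factor
(`kernelSW_le_mul`). The remaining factor `q` bounds the column sums of `H`.

The comparison with Ullrich's bound is elementary algebra in `s = √h`. -/

namespace SDPI

/-! ### Divergences, data processing and contraction constants. -/

section Divergence

variable {X Y : Type*} [Fintype X] [Fintype Y] {Φ : ℝ → ℝ}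

/-- `K` is a Markov kernel: its rows are probability distributions. -/
structure IsMarkovKernel (K : X → Y → ℝ) : Prop where
  nonneg : ∀ x y, 0 ≤ K x y
  sum_eq_one : ∀ x, ∑ y, K x y = 1

theorem push_mem_stdSimplex {K : X → Y → ℝ} (hK : IsMarkovKernel K) {ν : X → ℝ}
    (hν : ν ∈ stdSimplex ℝ X) : push ν K ∈ stdSimplex ℝ Y := by
  refine ⟨fun y => Finset.sum_nonneg fun x _ => mul_nonneg (hν.1 x) (hK.nonneg x y), ?_⟩
  unfold push
  rw [Finset.sum_comm]
  simp_rw [← Finset.mul_sum, hK.sum_eq_one, mul_one]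
  exact hν.2

theorem phiDiv_self {μ : X → ℝ} (hpos : ∀ x, 0 < μ x) (hμ : ∑ x, μ x = 1) :
    phiDiv Φ μ μ = 0 := by
  unfold phiDiv
  have : ∀ x, μ x / μ x = 1 := fun x => div_self (hpos x).ne'
  simp_rw [this, ← Finset.sum_mul, hμ]
  ring

theorem phiDiv_nonneg (hΦ : IsGenerating Φ) {ν μ : X → ℝ} (hpos : ∀ x, 0 < μ x)
    (hμ : ∑ x, μ x = 1) (hν : ν ∈ stdSimplex ℝ X) : 0 ≤ phiDiv Φ ν μ := by
  have h := hΦ.map_sum_le (t := Finset.univ) (w := μ) (p := fun x => ν x / μ x)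
    (fun x _ => (hpos x).le) hμ (fun x _ => div_nonneg (hν.1 x) (hpos x).le)
  have e : ∀ x, μ x * (ν x / μ x) = ν x := fun x => mul_div_cancel₀ _ (hpos x).ne'
  simp only [smul_eq_mul, e, hν.2] at h
  exact sub_nonneg.2 h

/-- The data processing inequality. -/
theorem phiDiv_push_le (hΦ : IsGenerating Φ) {ν μ : X → ℝ} {K : X → Y → ℝ}
    (hK : IsMarkovKernel K) (hpos : ∀ x, 0 < μ x) (hposK : ∀ y, 0 < push μ K y)
    (hν : ν ∈ stdSimplex ℝ X) :
    phiDiv Φ (push ν K) (push μ K) ≤ phiDiv Φ ν μ := by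
  refine sub_le_sub_right ?_ _
  -- Jensen under the posterior distribution of the input given the output `y`.
  have key : ∀ y, push μ K y * Φ (push ν K y / push μ K y) ≤
      ∑ x, μ x * K x y * Φ (ν x / μ x) := by
    intro y
    have h := hΦ.map_sum_le (t := Finset.univ) (w := fun x => μ x * K x y / push μ K y)
      (p := fun x => ν x / μ x)
      (fun x _ => div_nonneg (mul_nonneg (hpos x).le (hK.nonneg x y)) (hposK y).le)
      (by rw [← Finset.sum_div]; exact div_self (hposK y).ne')
      (fun x _ => div_nonneg (hν.1 x) (hpos x).le)
    have e : ∀ x, μ x * K x y / push μ K y * (ν x / μ x) = ν x * K x y / push μ K y := by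
      intro x
      have := (hpos x).ne'
      field_simp
    have e' : ∀ x, μ x * K x y / push μ K y * Φ (ν x / μ x) =
        μ x * K x y * Φ (ν x / μ x) / push μ K y := fun x => by ring
    simp only [smul_eq_mul, e, e', ← Finset.sum_div] at h
    rw [le_div_iff₀ (hposK y), mul_comm] at h
    exact h
  calc _ ≤ ∑ y, ∑ x, μ x * K x y * Φ (ν x / μ x) := Finset.sum_le_sum fun y _ => key y
    _ = ∑ x, μ x * Φ (ν x / μ x) := by
        rw [Finset.sum_comm]
        refine Finset.sum_congr rfl fun x _ => ?_
        rw [← Finset.sum_mul, ← Finset.mul_sum, hK.sum_eq_one, mul_one]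

variable {μ : X → ℝ} {K : X → Y → ℝ}

theorem ratio_le_one (hΦ : IsGenerating Φ) (hK : IsMarkovKernel K) (hpos : ∀ x, 0 < μ x)
    (hμ : ∑ x, μ x = 1) (hposK : ∀ y, 0 < push μ K y) {ν : X → ℝ} (hν : ν ∈ stdSimplex ℝ X) :
    phiDiv Φ (push ν K) (push μ K) / phiDiv Φ ν μ ≤ 1 :=
  div_le_one_of_le₀ (phiDiv_push_le hΦ hK hpos hposK hν) (phiDiv_nonneg hΦ hpos hμ hν)

theorem eta_le_one (hΦ : IsGenerating Φ) (hK : IsMarkovKernel K) (hpos : ∀ x, 0 < μ x)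
    (hμ : ∑ x, μ x = 1) (hposK : ∀ y, 0 < push μ K y) : eta Φ μ K ≤ 1 := by
  refine Real.sSup_le ?_ zero_le_one
  rintro r ⟨ν, hν, -, rfl⟩
  exact ratio_le_one hΦ hK hpos hμ hposK hν

theorem sum_push_eq_one (hK : IsMarkovKernel K) (hpos : ∀ x, 0 < μ x)
    (hμ : ∑ x, μ x = 1) : ∑ y, push μ K y = 1 :=
  (push_mem_stdSimplex hK ⟨fun x => (hpos x).le, hμ⟩).2

theorem eta_nonneg (hΦ : IsGenerating Φ) (hK : IsMarkovKernel K) (hpos : ∀ x, 0 < μ x)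
    (hμ : ∑ x, μ x = 1) (hposK : ∀ y, 0 < push μ K y) : 0 ≤ eta Φ μ K := by
  refine Real.sSup_nonneg ?_
  rintro r ⟨ν, hν, -, rfl⟩
  exact div_nonneg
    (phiDiv_nonneg hΦ hposK (sum_push_eq_one hK hpos hμ) (push_mem_stdSimplex hK hν))
    (phiDiv_nonneg hΦ hpos hμ hν)

/-- Data processing serves twice: it bounds the set of ratios, so that the supremum is genuine, and
it settles the case of zero divergence, where the ratio carries no information. -/
theorem phiDiv_push_le_eta_mul (hΦ : IsGenerating Φ) (hK : IsMarkovKernel K)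
    (hpos : ∀ x, 0 < μ x) (hμ : ∑ x, μ x = 1) (hposK : ∀ y, 0 < push μ K y) {ν : X → ℝ}
    (hν : ν ∈ stdSimplex ℝ X) :
    phiDiv Φ (push ν K) (push μ K) ≤ eta Φ μ K * phiDiv Φ ν μ := by
  rcases (phiDiv_nonneg hΦ hpos hμ hν).eq_or_lt with h0 | h0
  · have := phiDiv_push_le hΦ hK hpos hposK hν
    rw [← h0] at this ⊢
    simpa using this
  · have hne : ν ≠ μ := by
      rintro rfl
      rw [phiDiv_self hpos hμ] at h0
      exact h0.false
    rw [← div_le_iff₀ h0]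
    refine le_csSup ⟨1, ?_⟩ ⟨ν, hν, hne, rfl⟩
    rintro r ⟨ν', hν', -, rfl⟩
    exact ratio_le_one hΦ hK hpos hμ hposK hν'

theorem eta_le_of_forall (hΦ : IsGenerating Φ) (hpos : ∀ x, 0 < μ x)
    (hμ : ∑ x, μ x = 1) {c : ℝ} (hc : 0 ≤ c)
    (h : ∀ ν ∈ stdSimplex ℝ X, phiDiv Φ (push ν K) (push μ K) ≤ c * phiDiv Φ ν μ) :
    eta Φ μ K ≤ c := by
  -- `0 ≤ c` covers an empty set of ratios, whose `sSup` is `0`.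
  refine Real.sSup_le ?_ hc
  rintro r ⟨ν, hν, -, rfl⟩
  exact div_le_of_le_mul₀ (phiDiv_nonneg hΦ hpos hμ hν) hc (h ν hν)

theorem phiDiv_convex_combination_le (hΦ : IsGenerating Φ) (hpos : ∀ x, 0 < μ x) {ν₁ ν₂ : X → ℝ}
    (h₁ : ν₁ ∈ stdSimplex ℝ X) (h₂ : ν₂ ∈ stdSimplex ℝ X) {a b : ℝ} (ha : 0 ≤ a) (hb : 0 ≤ b)
    (hab : a + b = 1) :
    phiDiv Φ (fun x => a * ν₁ x + b * ν₂ x) μ ≤ a * phiDiv Φ ν₁ μ + b * phiDiv Φ ν₂ μ := by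
  have key : ∀ x, μ x * Φ ((a * ν₁ x + b * ν₂ x) / μ x) ≤
      a * (μ x * Φ (ν₁ x / μ x)) + b * (μ x * Φ (ν₂ x / μ x)) := by
    intro x
    have h := hΦ.2 (x := ν₁ x / μ x) (div_nonneg (h₁.1 x) (hpos x).le)
      (y := ν₂ x / μ x) (div_nonneg (h₂.1 x) (hpos x).le) ha hb hab
    simp only [smul_eq_mul] at h
    rw [show (a * ν₁ x + b * ν₂ x) / μ x = a * (ν₁ x / μ x) + b * (ν₂ x / μ x) by ring]
    nlinarith [mul_le_mul_of_nonneg_left h (hpos x).le]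
  have hs := Finset.sum_le_sum fun x (_ : x ∈ Finset.univ) => key x
  rw [Finset.sum_add_distrib, ← Finset.mul_sum, ← Finset.mul_sum] at hs
  unfold phiDiv
  have : Φ 1 = a * Φ 1 + b * Φ 1 := by rw [← add_mul, hab, one_mul]
  linarith

/-! ### Comparison of kernels with a common stationary distribution. -/

/-- Comparison of kernels with the common stationary distribution `μ`: if `L ≤ C K` pointwise, then
`D(νK‖μ) ≤ (1/C) D(νL‖μ) + (1 - 1/C) D(ν‖μ)`. -/
theorem phiDiv_push_le_of_le_mul (hΦ : IsGenerating Φ) {K L : X → X → ℝ} (hK : IsMarkovKernel K)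
    (hL : IsMarkovKernel L) (hpos : ∀ x, 0 < μ x) (hKμ : push μ K = μ)
    (hLμ : push μ L = μ) {C : ℝ} (hC : 1 < C) (hLK : ∀ x y, L x y ≤ C * K x y) {ν : X → ℝ}
    (hν : ν ∈ stdSimplex ℝ X) :
    phiDiv Φ (push ν K) μ ≤ C⁻¹ * phiDiv Φ (push ν L) μ + (1 - C⁻¹) * phiDiv Φ ν μ := by
  have hC0 : 0 < C := by linarith
  have hC1 : 0 < C - 1 := by linarith
  -- The residual kernel, determined by `K = C⁻¹ L + (1 - C⁻¹) R`.
  set R : X → X → ℝ := fun x y => (C * K x y - L x y) / (C - 1) with hR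
  have hRm : IsMarkovKernel R := by
    refine ⟨fun x y => div_nonneg (sub_nonneg.2 (hLK x y)) hC1.le, fun x => ?_⟩
    simp only [hR]
    rw [← Finset.sum_div, Finset.sum_sub_distrib, ← Finset.mul_sum, hK.sum_eq_one,
      hL.sum_eq_one, mul_one, div_self hC1.ne']
  have hpush : ∀ ρ : X → ℝ, push ρ R = fun y => (C * push ρ K y - push ρ L y) / (C - 1) := by
    intro ρ
    funext y
    simp only [push, hR]
    rw [Finset.mul_sum, ← Finset.sum_sub_distrib, Finset.sum_div]
    exact Finset.sum_congr rfl fun x _ => by ring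
  have hRμ : push μ R = μ := by
    rw [hpush, hKμ, hLμ]
    funext y
    field_simp
  have hdpi := phiDiv_push_le hΦ hRm hpos (by rw [hRμ]; exact hpos) hν
  rw [hRμ] at hdpi
  have hinv : 0 ≤ 1 - C⁻¹ := sub_nonneg.2 (inv_le_one_of_one_le₀ hC.le)
  have hcomb : push ν K = fun y => C⁻¹ * push ν L y + (1 - C⁻¹) * push ν R y := by
    rw [hpush]
    funext y
    field_simp
    ring
  calc phiDiv Φ (push ν K) μ
      ≤ C⁻¹ * phiDiv Φ (push ν L) μ + (1 - C⁻¹) * phiDiv Φ (push ν R) μ := by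
        rw [hcomb]
        exact phiDiv_convex_combination_le hΦ hpos (push_mem_stdSimplex hL hν)
          (push_mem_stdSimplex hRm hν) (inv_nonneg.2 hC0.le) hinv (by ring)
    _ ≤ _ := by gcongr

/-- Composition of kernels: first `K`, then `L`. -/
def kernelComp {Z : Type*} (K : X → Y → ℝ) (L : Y → Z → ℝ) (x : X) (z : Z) : ℝ :=
  ∑ y, K x y * L y z

theorem push_kernelComp {Z : Type*} (ν : X → ℝ) (K : X → Y → ℝ) (L : Y → Z → ℝ) :
    push ν (kernelComp K L) = push (push ν K) L := by
  funext z
  simp only [push, kernelComp, Finset.mul_sum, Finset.sum_mul]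
  rw [Finset.sum_comm]
  exact Finset.sum_congr rfl fun y _ => Finset.sum_congr rfl fun x _ => by ring

theorem IsMarkovKernel.comp {Z : Type*} [Fintype Z] {K : X → Y → ℝ} {L : Y → Z → ℝ}
    (hK : IsMarkovKernel K) (hL : IsMarkovKernel L) : IsMarkovKernel (kernelComp K L) := by
  refine ⟨fun x z => Finset.sum_nonneg fun y _ => mul_nonneg (hK.nonneg x y) (hL.nonneg y z),
    fun x => ?_⟩
  unfold kernelComp
  rw [Finset.sum_comm]
  simp_rw [← Finset.mul_sum, hL.sum_eq_one, mul_one, hK.sum_eq_one]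

/-- If `H K H ≤ C K` pointwise, then the SDPI constant of `K` is controlled by that of `H`. -/
theorem eta_le_of_sandwich_le (hΦ : IsGenerating Φ) {K H : X → X → ℝ} (hK : IsMarkovKernel K)
    (hH : IsMarkovKernel H) (hpos : ∀ x, 0 < μ x) (hμ : ∑ x, μ x = 1) (hKμ : push μ K = μ)
    (hHμ : push μ H = μ) {C : ℝ} (hC : 1 < C)
    (hle : ∀ x y, kernelComp H (kernelComp K H) x y ≤ C * K x y) :
    eta Φ μ K ≤ (C - 1) / (C - eta Φ μ H ^ 2) := by
  have hKpos : ∀ y, 0 < push μ K y := by rw [hKμ]; exact hpos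
  have hHpos : ∀ y, 0 < push μ H y := by rw [hHμ]; exact hpos
  have hC0 : 0 < C := by linarith
  have hKK := fun {ν} (hν : ν ∈ stdSimplex ℝ X) =>
    phiDiv_push_le_eta_mul hΦ hK hpos hμ hKpos hν
  have hHH := fun {ν} (hν : ν ∈ stdSimplex ℝ X) =>
    phiDiv_push_le_eta_mul hΦ hH hpos hμ hHpos hν
  have e0 : 0 ≤ eta Φ μ K := eta_nonneg hΦ hK hpos hμ hKpos
  have h0 : 0 ≤ eta Φ μ H := eta_nonneg hΦ hH hpos hμ hHpos
  have h1 : eta Φ μ H ≤ 1 := eta_le_one hΦ hH hpos hμ hHpos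
  set e := eta Φ μ K with he
  set h := eta Φ μ H with hh
  rw [hKμ] at hKK
  rw [hHμ] at hHH
  have hinv : 0 ≤ 1 - C⁻¹ := sub_nonneg.2 (inv_le_one_of_one_le₀ hC.le)
  -- The constant `e` appears on both sides; since `h² ≤ 1 < C`, the inequality can be solved for
  -- it.
  have hmain : e ≤ C⁻¹ * (h * (e * h)) + (1 - C⁻¹) := by
    rw [he]
    refine eta_le_of_forall hΦ hpos hμ (by positivity) fun ν hν => ?_
    rw [hKμ]
    have hcmp := phiDiv_push_le_of_le_mul hΦ hK (hH.comp (hK.comp hH)) hpos hKμ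
      (by rw [push_kernelComp, push_kernelComp, hHμ, hKμ, hHμ]) hC hle hν
    rw [push_kernelComp, push_kernelComp] at hcmp
    have b1 := hHH hν
    have b2 := hKK (push_mem_stdSimplex hH hν)
    have b3 := hHH (push_mem_stdSimplex hK (push_mem_stdSimplex hH hν))
    have b : phiDiv Φ (push (push (push ν H) K) H) μ ≤ h * (e * (h * phiDiv Φ ν μ)) :=
      b3.trans (mul_le_mul_of_nonneg_left
        (b2.trans (mul_le_mul_of_nonneg_left b1 e0)) h0)
    have b' := mul_le_mul_of_nonneg_left b (inv_nonneg.2 hC0.le)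
    calc _ ≤ _ := hcmp
      _ ≤ _ := add_le_add_left b' _
      _ = _ := by ring
  have hmul := mul_le_mul_of_nonneg_left hmain hC0.le
  have hexp : C * (C⁻¹ * (h * (e * h)) + (1 - C⁻¹)) = h * (e * h) + (C - 1) := by
    field_simp
  rw [hexp] at hmul
  have hden : 0 < C - h ^ 2 := by nlinarith
  rw [le_div_iff₀ hden]
  nlinarith

end Divergence

section PottsLemmas

variable {V : Type*} [Fintype V] [DecidableEq V] (G : SimpleGraph V) [DecidableRel G.Adj]
  (q : ℕ) (β : ℝ)

/-! ### The Gibbs distribution and the heat-bath kernel -/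

theorem partitionFn_pos [NeZero q] : 0 < partitionFn G q β :=
  Finset.sum_pos (fun _ _ => Real.exp_pos _) Finset.univ_nonempty

theorem gibbs_pos [NeZero q] (x : V → Fin q) : 0 < gibbs G q β x :=
  div_pos (Real.exp_pos _) (partitionFn_pos G q β)

theorem sum_gibbs [NeZero q] : ∑ x, gibbs G q β x = 1 := by
  unfold gibbs
  rw [← Finset.sum_div]
  exact div_self (partitionFn_pos G q β).ne'

theorem gibbsCond_nonneg [NeZero q] (v : V) (c : Fin q) (x : V → Fin q) :
    0 ≤ gibbsCond G q β v c x :=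
  div_nonneg (gibbs_pos G q β _).le (Finset.sum_nonneg fun _ _ => (gibbs_pos G q β _).le)

theorem sum_gibbsCond [NeZero q] (v : V) (x : V → Fin q) :
    ∑ c, gibbsCond G q β v c x = 1 := by
  unfold gibbsCond
  rw [← Finset.sum_div]
  exact div_self (Finset.sum_pos (fun _ _ => gibbs_pos G q β _) Finset.univ_nonempty).ne'

theorem gibbsCond_le_one [NeZero q] (v : V) (c : Fin q) (x : V → Fin q) :
    gibbsCond G q β v c x ≤ 1 := by
  rw [← sum_gibbsCond G q β v x]
  exact Finset.single_le_sum (fun c _ => gibbsCond_nonneg G q β v c x) (Finset.mem_univ c)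

/-- A sum over the colorings that agree with `x` off `v` is a sum over the colors of `v`. -/
theorem sum_mul_indicator_agree_off (v : V) (x : V → Fin q) (f : (V → Fin q) → ℝ) :
    ∑ y : V → Fin q, f y * (if ∀ u, u ≠ v → y u = x u then 1 else 0) =
      ∑ c : Fin q, f (Function.update x v c) := by
  simp_rw [mul_ite, mul_one, mul_zero]
  rw [← Finset.sum_filter]
  refine Finset.sum_nbij' (fun y => y v) (fun c => Function.update x v c) ?_ ?_ ?_ ?_ ?_
  · simp
  · intro c _
    simp +contextual [Function.update_of_ne]
  · intro y hy
    rw [Finset.mem_filter] at hy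
    funext u
    by_cases hu : u = v
    · subst hu; simp
    · simp [Function.update_of_ne hu, hy.2 u hu]
  · simp
  · intro y hy
    rw [Finset.mem_filter] at hy
    congr 1
    funext u
    by_cases hu : u = v
    · subst hu; simp
    · simp [Function.update_of_ne hu, hy.2 u hu]

theorem sum_gibbsCond_mul_indicator [NeZero q] (v : V) (x : V → Fin q) :
    ∑ y : V → Fin q, gibbsCond G q β v (y v) x *
      (if ∀ u, u ≠ v → y u = x u then 1 else 0) = 1 := by
  rw [sum_mul_indicator_agree_off q v x fun y => gibbsCond G q β v (y v) x]
  simpa using sum_gibbsCond G q β v x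

theorem isMarkovKernel_kernelHB [NeZero q] [Nonempty V] :
    IsMarkovKernel (kernelHB G q β) := by
  refine ⟨fun x y => mul_nonneg (by positivity) (Finset.sum_nonneg fun v _ =>
    mul_nonneg (gibbsCond_nonneg G q β _ _ _) (by split_ifs <;> norm_num)), fun x => ?_⟩
  unfold kernelHB
  rw [← Finset.mul_sum, Finset.sum_comm]
  simp_rw [sum_gibbsCond_mul_indicator]
  simp

theorem agree_off_comm (v : V) (x y : V → Fin q) :
    (∀ u, u ≠ v → x u = y u) ↔ ∀ u, u ≠ v → y u = x u :=
  forall₂_congr fun _ _ => eq_comm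

theorem gibbsCond_update (v : V) (c c' : Fin q) (x : V → Fin q) :
    gibbsCond G q β v c (Function.update x v c') = gibbsCond G q β v c x := by
  simp [gibbsCond]

/-- Each single-site update already preserves the Gibbs distribution: the conditional law at `v`
ignores the old color of `v`, so summing over that color leaves marginal times conditional. -/
theorem push_gibbs_kernelHB [NeZero q] [Nonempty V] :
    push (gibbs G q β) (kernelHB G q β) = gibbs G q β := by
  funext y
  have key : ∀ v : V, ∑ x : V → Fin q, gibbs G q β x * (gibbsCond G q β v (y v) x *
      (if ∀ u, u ≠ v → y u = x u then 1 else 0)) = gibbs G q β y := by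
    intro v
    simp_rw [← mul_assoc, agree_off_comm q v y]
    rw [sum_mul_indicator_agree_off q v y fun x => gibbs G q β x * gibbsCond G q β v (y v) x]
    simp_rw [gibbsCond_update]
    rw [← Finset.sum_mul, gibbsCond, Function.update_eq_self]
    exact mul_div_cancel₀ _
      (Finset.sum_pos (fun _ _ => gibbs_pos G q β _) Finset.univ_nonempty).ne'
  simp only [push, kernelHB, Finset.mul_sum]
  rw [Finset.sum_comm]
  simp_rw [mul_left_comm _ (1 / (Fintype.card V : ℝ)), ← Finset.mul_sum, key]
  simp

/-- The column sums of the heat-bath kernel are at most `q`. -/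
theorem sum_kernelHB_le [NeZero q] [Nonempty V] (y : V → Fin q) :
    ∑ x, kernelHB G q β x y ≤ q := by
  unfold kernelHB
  rw [← Finset.mul_sum, Finset.sum_comm]
  have key : ∀ v : V, ∑ x : V → Fin q, gibbsCond G q β v (y v) x *
      (if ∀ u, u ≠ v → y u = x u then 1 else 0) ≤ q := by
    intro v
    simp_rw [agree_off_comm q v y]
    rw [sum_mul_indicator_agree_off q v y fun x => gibbsCond G q β v (y v) x]
    refine (Finset.sum_le_sum fun c _ => gibbsCond_le_one G q β v (y v) _).trans ?_
    simp
  calc _ ≤ 1 / (Fintype.card V : ℝ) * ∑ _v : V, (q : ℝ) := by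
        gcongr with v; exact key v
    _ = q := by simp

theorem exists_agree_off_of_kernelHB_ne_zero {x y : V → Fin q} (h : kernelHB G q β x y ≠ 0) :
    ∃ v, ∀ u, u ≠ v → y u = x u := by
  by_contra hn
  push Not at hn
  refine h ?_
  unfold kernelHB
  rw [Finset.sum_eq_zero, mul_zero]
  intro v _
  obtain ⟨u, hu, hne⟩ := hn v
  rw [if_neg fun hall => hne (hall u hu), mul_zero]

/-! ### The Swendsen–Wang kernel -/

variable {G q β}

theorem monoEdges_subset (x : V → Fin q) : monoEdges G q x ⊆ G.edgeFinset :=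
  Finset.filter_subset _ _

/-- Binomial theorem: subsets of `E(x)` weighted by `(e^β - 1)^|A|` sum to `((e^β - 1) + 1)^|E(x)|`.
-/
theorem sum_coupling_powerset (x : V → Fin q) :
    ∑ A ∈ G.edgeFinset.powerset, coupling G q β x A = gibbs G q β x := by
  unfold coupling gibbs
  rw [← Finset.sum_div]
  congr 1
  rw [← Finset.sum_filter]
  have : G.edgeFinset.powerset.filter (· ⊆ monoEdges G q x) = (monoEdges G q x).powerset := by
    ext A
    simp only [Finset.mem_filter, Finset.mem_powerset]
    exact ⟨fun h => h.2, fun h => ⟨h.trans (monoEdges_subset x), h⟩⟩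
  rw [this]
  have h := Finset.sum_pow_mul_eq_add_pow (Real.exp β - 1) 1 (monoEdges G q x)
  simp only [one_pow, mul_one, sub_add_cancel] at h
  rw [h, ← Real.exp_nat_mul, mul_comm]

theorem exp_sub_one_nonneg (hβ : 0 ≤ β) : 0 ≤ Real.exp β - 1 :=
  sub_nonneg.2 (Real.one_le_exp hβ)

theorem coupling_nonneg [NeZero q] (hβ : 0 ≤ β) (x : V → Fin q) (A : Finset (Sym2 V)) :
    0 ≤ coupling G q β x A := by
  have := exp_sub_one_nonneg hβ
  have := (partitionFn_pos G q β).le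
  unfold coupling
  split_ifs <;> positivity

variable (G q) in
/-- The number of colorings that are constant along the edges of `A`. -/
def numCompatible (A : Finset (Sym2 V)) : ℕ :=
  (Finset.univ.filter fun y : V → Fin q => A ⊆ monoEdges G q y).card

theorem numCompatible_pos_of_subset {A : Finset (Sym2 V)} {x : V → Fin q}
    (h : A ⊆ monoEdges G q x) : 0 < numCompatible G q A :=
  Finset.card_pos.2 ⟨x, by simpa using h⟩

theorem sum_coupling_univ (A : Finset (Sym2 V)) :
    ∑ y : V → Fin q, coupling G q β y A =
      (Real.exp β - 1) ^ A.card * numCompatible G q A / partitionFn G q β := by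
  unfold coupling numCompatible
  rw [← Finset.sum_div, ← Finset.sum_filter, Finset.sum_const, nsmul_eq_mul, mul_comm]

theorem coloringGivenEdges_mul_sum [NeZero q] (hβ : 0 ≤ β) (A : Finset (Sym2 V))
    (x : V → Fin q) :
    coloringGivenEdges G q β A x * ∑ y, coupling G q β y A = coupling G q β x A := by
  refine div_mul_cancel_of_imp fun h => ?_
  exact (Finset.sum_eq_zero_iff_of_nonneg fun y _ => coupling_nonneg hβ y A).1 h x
    (Finset.mem_univ x)

theorem push_gibbs_kernelSW [NeZero q] (hβ : 0 ≤ β) :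
    push (gibbs G q β) (kernelSW G q β) = gibbs G q β := by
  funext y
  simp only [push, kernelSW, Finset.mul_sum]
  rw [Finset.sum_comm, ← sum_coupling_powerset y]
  refine Finset.sum_congr rfl fun A _ => ?_
  rw [← coloringGivenEdges_mul_sum hβ A y, Finset.mul_sum]
  refine Finset.sum_congr rfl fun x _ => ?_
  rw [edgesGivenColoring, sum_coupling_powerset]
  have := (gibbs_pos G q β x).ne'
  field_simp

theorem isMarkovKernel_kernelSW [NeZero q] (hβ : 0 ≤ β) :
    IsMarkovKernel (kernelSW G q β) := by
  have hc := coupling_nonneg (G := G) (q := q) hβ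
  refine ⟨fun x y => Finset.sum_nonneg fun A _ => mul_nonneg
    (div_nonneg (hc _ _) (Finset.sum_nonneg fun _ _ => hc _ _))
    (div_nonneg (hc _ _) (Finset.sum_nonneg fun _ _ => hc _ _)), fun x => ?_⟩
  unfold kernelSW
  rw [Finset.sum_comm]
  have key : ∀ A, ∑ y, coloringGivenEdges G q β A y * edgesGivenColoring G q β x A =
      edgesGivenColoring G q β x A := by
    intro A
    rw [← Finset.sum_mul]
    -- On an edge set of probability zero the conditional law is `0/0 = 0`, not a distribution, but
    -- `x` never produces that set.
    by_cases h : ∑ y, coupling G q β y A = 0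
    · have h0 := (Finset.sum_eq_zero_iff_of_nonneg fun y _ => hc y A).1 h x (Finset.mem_univ x)
      simp [edgesGivenColoring, h0]
    · unfold coloringGivenEdges
      rw [← Finset.sum_div, div_self h, one_mul]
  simp_rw [key, edgesGivenColoring]
  rw [← Finset.sum_div, sum_coupling_powerset, div_self (gibbs_pos G q β x).ne']

/-- The Swendsen–Wang kernel in closed form. -/
theorem kernelSW_eq [NeZero q] (x y : V → Fin q) :
    kernelSW G q β x y = (Real.exp (β * (monoEdges G q x).card))⁻¹ *
      ∑ A ∈ (monoEdges G q x ∩ monoEdges G q y).powerset,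
        (Real.exp β - 1) ^ A.card / numCompatible G q A := by
  have hZ := (partitionFn_pos G q β).ne'
  unfold kernelSW
  have hsub : (monoEdges G q x ∩ monoEdges G q y).powerset ⊆ G.edgeFinset.powerset :=
    Finset.powerset_mono.2 (Finset.inter_subset_left.trans (monoEdges_subset x))
  rw [← Finset.sum_subset hsub, Finset.mul_sum]
  · refine Finset.sum_congr rfl fun A hA => ?_
    rw [Finset.mem_powerset, Finset.subset_inter_iff] at hA
    rw [coloringGivenEdges, edgesGivenColoring, sum_coupling_powerset, sum_coupling_univ, coupling,
      coupling, if_pos hA.1, if_pos hA.2, gibbs]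
    have hn : (numCompatible G q A : ℝ) ≠ 0 :=
      Nat.cast_ne_zero.2 (numCompatible_pos_of_subset hA.1).ne'
    have he := (Real.exp_pos (β * (monoEdges G q x).card)).ne'
    by_cases ht : (Real.exp β - 1) ^ A.card = 0
    · simp [ht]
    · field_simp
  · intro A _ hA
    rw [Finset.mem_powerset, Finset.subset_inter_iff, not_and_or] at hA
    rcases hA with hA | hA
    · simp [edgesGivenColoring, coupling, hA]
    · simp [coloringGivenEdges, coupling, hA]

/-! ### Adding edges to the constraint set -/

theorem mk_mem_monoEdges {x : V → Fin q} {a b : V} :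
    s(a, b) ∈ monoEdges G q x ↔ G.Adj a b ∧ x a = x b := by
  simp [monoEdges]

/-- With colors read in `ℤ/q`, the colorings constant along `A` are closed under subtraction. -/
theorem subset_monoEdges_sub [NeZero q] {A : Finset (Sym2 V)} {x y : V → Fin q}
    (hx : A ⊆ monoEdges G q x) (hy : A ⊆ monoEdges G q y) :
    A ⊆ monoEdges G q (x - y) := by
  intro e he
  have h1 := hx he
  have h2 := hy he
  induction e using Sym2.ind with
  | _ a b =>
    rw [mk_mem_monoEdges] at h1 h2 ⊢
    exact ⟨h1.1, by simp [h1.2, h2.2]⟩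

/-- Sort the colorings compatible with `A` by the difference `d` of the two end colors of the new
edge. Subtracting a fixed member of a fibre injects that fibre into the colorings compatible with
the enlarged set, and there are `q` fibres. -/
theorem numCompatible_le_mul_insert [NeZero q] (A : Finset (Sym2 V)) {e : Sym2 V}
    (he : e ∈ G.edgeFinset) :
    numCompatible G q A ≤ q * numCompatible G q (insert e A) := by
  induction e using Sym2.ind with
  | _ a b =>
    have hadj : G.Adj a b := by simpa using he
    set S := Finset.univ.filter fun y : V → Fin q => A ⊆ monoEdges G q y with hS
    have hmem : ∀ y, y ∈ S ↔ A ⊆ monoEdges G q y := by simp [hS]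
    have hfib : ∀ d ∈ (Finset.univ : Finset (Fin q)), (S.filter fun y => y a - y b = d).card ≤
        numCompatible G q (insert s(a, b) A) := by
      intro d _
      rcases (S.filter fun y => y a - y b = d).eq_empty_or_nonempty with h | ⟨y₀, hy₀⟩
      · rw [h]; simp
      · rw [Finset.mem_filter, hmem] at hy₀
        refine Finset.card_le_card_of_injOn (fun y => y - y₀) ?_
          (fun _ _ _ _ h => sub_left_injective h)
        intro y hy
        rw [Finset.mem_coe, Finset.mem_filter, hmem] at hy
        rw [Finset.mem_coe, Finset.mem_filter]
        refine ⟨Finset.mem_univ _, Finset.insert_subset ?_ (subset_monoEdges_sub hy.1 hy₀.1)⟩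
        rw [mk_mem_monoEdges]
        refine ⟨hadj, ?_⟩
        have h := hy.2.trans hy₀.2.symm
        simp only [Pi.sub_apply]
        rw [sub_eq_sub_iff_add_eq_add] at h ⊢
        rw [h, add_comm]
    have h := Finset.card_le_mul_card_image_of_maps_to
      (f := fun y : V → Fin q => y a - y b) (s := S) (fun _ _ => Finset.mem_univ _) _ hfib
    rw [Finset.card_univ, Fintype.card_fin, mul_comm] at h
    exact h

theorem numCompatible_le_pow_mul [NeZero q] (A : Finset (Sym2 V)) {D : Finset (Sym2 V)}
    (hD : D ⊆ G.edgeFinset) :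
    numCompatible G q A ≤ q ^ D.card * numCompatible G q (A ∪ D) := by
  induction D using Finset.induction_on with
  | empty => simp
  | insert e D he ih =>
    rw [Finset.insert_subset_iff] at hD
    calc numCompatible G q A ≤ q ^ D.card * numCompatible G q (A ∪ D) := ih hD.2
      _ ≤ q ^ D.card * (q * numCompatible G q (insert e (A ∪ D))) :=
          Nat.mul_le_mul_left _ (numCompatible_le_mul_insert _ hD.1)
      _ = _ := by
          rw [Finset.card_insert_of_notMem he, Finset.union_insert, pow_succ, mul_assoc]

/-! ### Stability of the Swendsen–Wang kernel under local recoloring. -/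

theorem sum_powerset_union_of_disjoint {α : Type*} [DecidableEq α] {S T : Finset α}
    (h : Disjoint S T) (f : Finset α → ℝ) :
    ∑ A ∈ (S ∪ T).powerset, f A = ∑ B ∈ S.powerset, ∑ C ∈ T.powerset, f (B ∪ C) := by
  rw [← Finset.sum_product']
  symm
  refine Finset.sum_nbij' (fun p => p.1 ∪ p.2) (fun A => (A ∩ S, A ∩ T)) ?_ ?_ ?_ ?_ ?_
  · simp only [Finset.mem_product, Finset.mem_powerset]
    exact fun p hp => Finset.union_subset_union hp.1 hp.2
  · simp
  · simp only [Finset.mem_product, Finset.mem_powerset]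
    rintro ⟨B, C⟩ ⟨hB, hC⟩
    have h1 : C ∩ S = ∅ :=
      Finset.disjoint_iff_inter_eq_empty.1 ((h.mono_right hC).symm)
    have h2 : B ∩ T = ∅ := Finset.disjoint_iff_inter_eq_empty.1 (h.mono_left hB)
    simp only [Finset.union_inter_distrib_right, h1, h2, Finset.inter_eq_left.2 hB,
      Finset.inter_eq_left.2 hC, Finset.union_empty, Finset.empty_union]
  · simp only [Finset.mem_powerset]
    intro A hA
    rw [← Finset.inter_union_distrib_left, Finset.inter_eq_left.2 hA]
  · simp

/-- Changing the two colorings only on the endpoints of the edges in `D` changes the transition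
probabilities of the Swendsen–Wang kernel by a factor of at most `q^|D| e^(β|D|)`. -/
theorem kernelSW_le_mul [NeZero q] (hβ : 0 ≤ β) {D : Finset (Sym2 V)} (hD : D ⊆ G.edgeFinset)
    {x y x₁ y₁ : V → Fin q} (hx : monoEdges G q x₁ \ D = monoEdges G q x \ D)
    (hy : monoEdges G q y₁ \ D = monoEdges G q y \ D) :
    kernelSW G q β x₁ y₁ ≤ (q : ℝ) ^ D.card * Real.exp (β * D.card) * kernelSW G q β x y := by
  have ht := exp_sub_one_nonneg hβ
  have hq : (1 : ℝ) ≤ q := by exact_mod_cast NeZero.one_le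
  set t := Real.exp β - 1 with ht_def
  set F := monoEdges G q x ∩ monoEdges G q y with hF
  set F₁ := monoEdges G q x₁ ∩ monoEdges G q y₁ with hF₁
  set g : Finset (Sym2 V) → ℝ := fun A => t ^ A.card / numCompatible G q A with hg
  have hg0 : ∀ A, 0 ≤ g A := fun A => by positivity
  have hFD : F₁ \ D = F \ D := by
    have hdist : ∀ S T : Finset (Sym2 V), (S ∩ T) \ D = (S \ D) ∩ (T \ D) := by
      intro S T
      ext e
      simp only [Finset.mem_sdiff, Finset.mem_inter]
      tauto
    rw [hF, hF₁, hdist, hdist, hx, hy]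
  -- `B` is the part of the edge set off `D`, available to both pairs of colorings; discarding `C ⊆
  -- D` costs at most `q^|C| ≤ q^|D|`.
  have hterm : ∀ B ∈ (F₁ \ D).powerset, ∀ C ∈ (F₁ ∩ D).powerset,
      g (B ∪ C) ≤ (q : ℝ) ^ D.card * g B * t ^ C.card := by
    intro B hB C hC
    rw [Finset.mem_powerset] at hB hC
    have hdisj : Disjoint B C := by
      refine (Finset.disjoint_sdiff_inter F₁ D).mono hB hC
    have hCD : C ⊆ D := hC.trans Finset.inter_subset_right
    have hsub : B ∪ C ⊆ monoEdges G q x₁ :=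
      (Finset.union_subset (hB.trans Finset.sdiff_subset)
        (hC.trans Finset.inter_subset_left)).trans Finset.inter_subset_left
    have hn : (0 : ℝ) < numCompatible G q (B ∪ C) := by
      exact_mod_cast numCompatible_pos_of_subset hsub
    have hnB : (0 : ℝ) < numCompatible G q B := by
      exact_mod_cast numCompatible_pos_of_subset (Finset.subset_union_left.trans hsub)
    have hle : (numCompatible G q B : ℝ) ≤ (q : ℝ) ^ D.card * numCompatible G q (B ∪ C) := by
      have h : (numCompatible G q B : ℝ) ≤ (q : ℝ) ^ C.card * numCompatible G q (B ∪ C) := by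
        exact_mod_cast numCompatible_le_pow_mul B (hCD.trans hD)
      refine h.trans ?_
      gcongr
    simp only [hg]
    rw [Finset.card_union_of_disjoint hdisj, pow_add, div_le_iff₀ hn]
    calc t ^ B.card * t ^ C.card
        = t ^ B.card * t ^ C.card / numCompatible G q B * numCompatible G q B := by field_simp
      _ ≤ t ^ B.card * t ^ C.card / numCompatible G q B *
          ((q : ℝ) ^ D.card * numCompatible G q (B ∪ C)) := by gcongr
      _ = _ := by ring
  have hsum : ∑ A ∈ F₁.powerset, g A ≤
      (q : ℝ) ^ D.card * Real.exp (β * (F₁ ∩ D).card) * ∑ A ∈ F.powerset, g A := by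
    have hsplit : F₁ = F₁ \ D ∪ F₁ ∩ D := (Finset.sdiff_union_inter F₁ D).symm
    have hpow : ∑ C ∈ (F₁ ∩ D).powerset, t ^ C.card = Real.exp (β * (F₁ ∩ D).card) := by
      have h := Finset.sum_pow_mul_eq_add_pow t 1 (F₁ ∩ D)
      simp only [one_pow, mul_one, ht_def, sub_add_cancel] at h
      rw [ht_def, h, ← Real.exp_nat_mul, mul_comm]
    calc ∑ A ∈ F₁.powerset, g A
        = ∑ B ∈ (F₁ \ D).powerset, ∑ C ∈ (F₁ ∩ D).powerset, g (B ∪ C) := by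
          rw [← sum_powerset_union_of_disjoint (Finset.disjoint_sdiff_inter F₁ D), ← hsplit]
      _ ≤ ∑ B ∈ (F₁ \ D).powerset, ∑ C ∈ (F₁ ∩ D).powerset,
            (q : ℝ) ^ D.card * g B * t ^ C.card :=
          Finset.sum_le_sum fun B hB => Finset.sum_le_sum fun C hC => hterm B hB C hC
      _ = (q : ℝ) ^ D.card * Real.exp (β * (F₁ ∩ D).card) *
            ∑ B ∈ (F \ D).powerset, g B := by
          simp_rw [← Finset.mul_sum, hpow, hFD]
          rw [← Finset.sum_mul, ← Finset.mul_sum]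
          ring
      _ ≤ _ := by
          refine mul_le_mul_of_nonneg_left ?_ (by positivity)
          exact Finset.sum_le_sum_of_subset_of_nonneg
            (Finset.powerset_mono.2 Finset.sdiff_subset) fun A _ _ => hg0 A
  -- The sum over `C` produced `e^(β|F₁ ∩ D|)`. As `E(x)` and `E(x₁)` agree off `D`, the ratio of
  -- the two normalizations absorbs it, leaving only `e^(β|D|)`.
  have hcard : (F₁ ∩ D).card + (monoEdges G q x).card ≤ D.card + (monoEdges G q x₁).card := by
    have h1 := Finset.card_sdiff_add_card_inter (monoEdges G q x) D
    have h2 := Finset.card_sdiff_add_card_inter (monoEdges G q x₁) D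
    have h3 : (monoEdges G q x ∩ D).card ≤ D.card := Finset.card_le_card Finset.inter_subset_right
    have h4 : (F₁ ∩ D).card ≤ (monoEdges G q x₁ ∩ D).card :=
      Finset.card_le_card (Finset.inter_subset_inter_right Finset.inter_subset_left)
    rw [hx] at h2
    omega
  have hexp : (Real.exp (β * (monoEdges G q x₁).card))⁻¹ * Real.exp (β * (F₁ ∩ D).card) ≤
      Real.exp (β * D.card) * (Real.exp (β * (monoEdges G q x).card))⁻¹ := by
    rw [← Real.exp_neg, ← Real.exp_neg, ← Real.exp_add, ← Real.exp_add, Real.exp_le_exp]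
    have hcast : ((F₁ ∩ D).card : ℝ) + (monoEdges G q x).card ≤
        D.card + (monoEdges G q x₁).card := by exact_mod_cast hcard
    nlinarith
  have hs0 : 0 ≤ ∑ A ∈ F.powerset, g A := Finset.sum_nonneg fun A _ => hg0 A
  rw [kernelSW_eq, kernelSW_eq]
  calc _ ≤ (Real.exp (β * (monoEdges G q x₁).card))⁻¹ *
        ((q : ℝ) ^ D.card * Real.exp (β * (F₁ ∩ D).card) * ∑ A ∈ F.powerset, g A) :=
        mul_le_mul_of_nonneg_left hsum (by positivity)
    _ = ((Real.exp (β * (monoEdges G q x₁).card))⁻¹ * Real.exp (β * (F₁ ∩ D).card)) *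
        ((q : ℝ) ^ D.card * ∑ A ∈ F.powerset, g A) := by ring
    _ ≤ (Real.exp (β * D.card) * (Real.exp (β * (monoEdges G q x).card))⁻¹) *
        ((q : ℝ) ^ D.card * ∑ A ∈ F.powerset, g A) :=
        mul_le_mul_of_nonneg_right hexp (by positivity)
    _ = _ := by ring

theorem monoEdges_sdiff_eq_of_agree_off {v : V} {x y : V → Fin q}
    (h : ∀ u, u ≠ v → y u = x u) {D : Finset (Sym2 V)} (hD : G.incidenceFinset v ⊆ D) :
    monoEdges G q y \ D = monoEdges G q x \ D := by
  ext e
  rw [Finset.mem_sdiff, Finset.mem_sdiff]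
  refine and_congr_left fun he => ?_
  induction e using Sym2.ind with
  | _ a b =>
    rw [mk_mem_monoEdges, mk_mem_monoEdges]
    refine and_congr_right fun hadj => ?_
    have hn : v ∉ s(a, b) := fun hv =>
      he (hD ((G.mem_incidenceFinset v _).2 ⟨hadj, hv⟩))
    rw [Sym2.mem_iff, not_or] at hn
    rw [h a (Ne.symm hn.1), h b (Ne.symm hn.2)]

/-- Take `D` to be the union of the stars at `v` and `w`. Since `|D| ≤ 2Δ`, even the exponent `2βΔ`
would do. -/
theorem kernelSW_le_mul_of_agree_off [NeZero q] (hβ : 0 ≤ β) {v w : V} {x y x₁ y₁ : V → Fin q}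
    (hx : ∀ u, u ≠ v → x₁ u = x u) (hy : ∀ u, u ≠ w → y u = y₁ u) :
    kernelSW G q β x₁ y₁ ≤
      (q : ℝ) ^ (2 * G.maxDegree) * Real.exp (4 * β * G.maxDegree) * kernelSW G q β x y := by
  set D := G.incidenceFinset v ∪ G.incidenceFinset w with hD
  have hcard : D.card ≤ 2 * G.maxDegree := by
    refine (Finset.card_union_le _ _).trans ?_
    rw [G.card_incidenceFinset_eq_degree, G.card_incidenceFinset_eq_degree]
    have := G.degree_le_maxDegree v
    have := G.degree_le_maxDegree w
    omega
  have hq : (1 : ℝ) ≤ q := by exact_mod_cast NeZero.one_le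
  refine (kernelSW_le_mul hβ
    (Finset.union_subset (G.incidenceFinset_subset v) (G.incidenceFinset_subset w))
    (monoEdges_sdiff_eq_of_agree_off hx Finset.subset_union_left)
    (monoEdges_sdiff_eq_of_agree_off hy Finset.subset_union_right).symm).trans ?_
  refine mul_le_mul_of_nonneg_right ?_ ((isMarkovKernel_kernelSW hβ).nonneg x y)
  refine mul_le_mul (pow_le_pow_right₀ hq hcard) (Real.exp_le_exp.2 ?_) (Real.exp_pos _).le
    (by positivity)
  have hcast : (D.card : ℝ) ≤ 2 * G.maxDegree := by exact_mod_cast hcard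
  nlinarith [mul_le_mul_of_nonneg_left hcast hβ, mul_nonneg hβ (Nat.cast_nonneg G.maxDegree)]

/-- Wherever both heat-bath factors are nonzero, each argument of the middle factor moves at one
vertex only, so that factor can be pulled out. The left heat-bath kernel then contributes a row sum
`1`, the right one a column sum at most `q`. -/
theorem kernelHB_kernelSW_kernelHB_le [NeZero q] [Nonempty V] (hβ : 0 ≤ β) (x y : V → Fin q) :
    kernelComp (kernelHB G q β) (kernelComp (kernelSW G q β) (kernelHB G q β)) x y ≤
      comparisonConst G q β * kernelSW G q β x y := by
  have hH := isMarkovKernel_kernelHB G q β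
  have hS := isMarkovKernel_kernelSW (G := G) (q := q) hβ
  set c := (q : ℝ) ^ (2 * G.maxDegree) * Real.exp (4 * β * G.maxDegree) with hc
  have hterm : ∀ x₁ y₁, kernelHB G q β x x₁ * (kernelSW G q β x₁ y₁ * kernelHB G q β y₁ y) ≤
      kernelHB G q β x x₁ * (c * kernelSW G q β x y * kernelHB G q β y₁ y) := by
    intro x₁ y₁
    by_cases h1 : kernelHB G q β x x₁ = 0
    · simp [h1]
    by_cases h2 : kernelHB G q β y₁ y = 0
    · simp [h2]
    obtain ⟨v, hv⟩ := exists_agree_off_of_kernelHB_ne_zero G q β h1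
    obtain ⟨w, hw⟩ := exists_agree_off_of_kernelHB_ne_zero G q β h2
    exact mul_le_mul_of_nonneg_left (mul_le_mul_of_nonneg_right
      (kernelSW_le_mul_of_agree_off hβ hv hw) (hH.nonneg _ _)) (hH.nonneg _ _)
  have hcS : 0 ≤ c * kernelSW G q β x y := mul_nonneg (by positivity) (hS.nonneg x y)
  unfold kernelComp
  calc _ = ∑ x₁, ∑ y₁, kernelHB G q β x x₁ * (kernelSW G q β x₁ y₁ * kernelHB G q β y₁ y) := by
        simp_rw [Finset.mul_sum]
    _ ≤ ∑ x₁, ∑ y₁, kernelHB G q β x x₁ * (c * kernelSW G q β x y * kernelHB G q β y₁ y) :=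
        Finset.sum_le_sum fun x₁ _ => Finset.sum_le_sum fun y₁ _ => hterm x₁ y₁
    _ = c * kernelSW G q β x y * ∑ y₁, kernelHB G q β y₁ y := by
        simp_rw [← Finset.mul_sum]
        rw [← Finset.sum_mul, hH.sum_eq_one, one_mul]
    _ ≤ c * kernelSW G q β x y * q :=
        mul_le_mul_of_nonneg_left (sum_kernelHB_le G q β y) hcS
    _ = _ := by
        rw [hc, comparisonConst, pow_succ]
        ring

theorem two_le_comparisonConst (hq : 2 ≤ q) (hβ : 0 ≤ β) : 2 ≤ comparisonConst G q β := by
  have hq' : (2 : ℝ) ≤ q := by exact_mod_cast hq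
  have h1 : (2 : ℝ) ≤ (q : ℝ) ^ (2 * G.maxDegree + 1) :=
    hq'.trans (le_self_pow₀ (by linarith) (by omega))
  have h2 : 1 ≤ Real.exp (4 * β * G.maxDegree) := Real.one_le_exp (by positivity)
  unfold comparisonConst
  nlinarith

end PottsLemmas

/-! ### Comparison with Ullrich's bound -/

theorem isGenerating_sq_sub_one : IsGenerating fun u : ℝ => (u - 1) ^ 2 := by
  refine ⟨convex_Ici 0, fun x _ y _ a b ha hb hab => ?_⟩
  obtain rfl : b = 1 - a := by linarith
  simp only [smul_eq_mul]
  nlinarith [mul_nonneg (mul_nonneg ha hb) (sq_nonneg (x - y))]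

/-- Here `s = √h`. The left fraction is `1 - (1 - s⁴)/(C - s⁴)`, at most `1 - (1 - s)/C²` because
`s⁴ ≤ s` and `C - s⁴ ≤ C²`. Expanding the square on the right gives the same expression plus `(1 -
s)²/(4C⁴)`, the gap that yields strictness for `s < 1`. -/
theorem sub_one_div_sub_sq_le {C s : ℝ} (hC : 2 ≤ C) (hs0 : 0 ≤ s) (hs1 : s ≤ 1) :
    (C - 1) / (C - (s ^ 2) ^ 2) + (1 - s) ^ 2 / (4 * C ^ 4) ≤
      ((2 * C ^ 2 - 1 + s) / (2 * C ^ 2)) ^ 2 := by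
  have h4 : (s ^ 2) ^ 2 ≤ s := by
    have h2 : s ^ 2 ≤ s := by nlinarith
    nlinarith [sq_nonneg s]
  have hden : 0 < C - (s ^ 2) ^ 2 := by linarith
  have hCC : C - (s ^ 2) ^ 2 ≤ C ^ 2 := by nlinarith [sq_nonneg (s ^ 2)]
  have h1 : (1 - s) / C ^ 2 ≤ (1 - (s ^ 2) ^ 2) / (C - (s ^ 2) ^ 2) :=
    div_le_div₀ (by linarith) (by linarith) hden hCC
  have e1 : (C - 1) / (C - (s ^ 2) ^ 2) = 1 - (1 - (s ^ 2) ^ 2) / (C - (s ^ 2) ^ 2) := by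
    rw [eq_sub_iff_add_eq, ← add_div, div_eq_one_iff_eq hden.ne']
    ring
  have e2 : ((2 * C ^ 2 - 1 + s) / (2 * C ^ 2)) ^ 2 =
      1 - (1 - s) / C ^ 2 + (1 - s) ^ 2 / (4 * C ^ 4) := by
    field_simp
    ring
  rw [e1, e2]
  linarith

theorem sqrt_sub_one_div_le {C h : ℝ} (hC : 2 ≤ C) (h0 : 0 ≤ h) (h1 : h ≤ 1) :
    √((C - 1) / (C - h ^ 2)) ≤ (2 * C ^ 2 - 1 + √h) / (2 * C ^ 2) ∧
      (h < 1 → √((C - 1) / (C - h ^ 2)) < (2 * C ^ 2 - 1 + √h) / (2 * C ^ 2)) := by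
  have key := sub_one_div_sub_sq_le hC (Real.sqrt_nonneg h) (Real.sqrt_le_one.2 h1)
  rw [Real.sq_sqrt h0] at key
  have hnum : 0 < 2 * C ^ 2 - 1 + √h := by nlinarith [Real.sqrt_nonneg h]
  have hrhs : 0 < (2 * C ^ 2 - 1 + √h) / (2 * C ^ 2) := by positivity
  refine ⟨Real.sqrt_le_iff.2 ⟨hrhs.le, ?_⟩, fun hlt => (Real.sqrt_lt' hrhs).2 ?_⟩
  · have : 0 ≤ (1 - √h) ^ 2 / (4 * C ^ 4) := by positivity
    linarith
  · have hs : √h < 1 := by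
      rw [Real.sqrt_lt' one_pos]
      simpa using hlt
    have : 0 < (1 - √h) ^ 2 / (4 * C ^ 4) :=
      div_pos (pow_pos (sub_pos.2 hs) 2) (by positivity)
    linarith

end SDPI

theorem mainTheorem10 {V : Type*} [Fintype V] [DecidableEq V] [Nonempty V]
    (G : SimpleGraph V) [DecidableRel G.Adj] (q : ℕ) (hq : 2 ≤ q) (β : ℝ) (hβ : 0 ≤ β) :
    -- the comparison bound, for every homogeneous generating function
    (∀ Φ : ℝ → ℝ, SDPI.IsGenerating Φ → SDPI.IsHomogeneous Φ →
      SDPI.eta Φ (SDPI.gibbs G q β) (SDPI.kernelSW G q β) ≤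
        (SDPI.comparisonConst G q β - 1) /
          (SDPI.comparisonConst G q β -
            (SDPI.eta Φ (SDPI.gibbs G q β) (SDPI.kernelHB G q β)) ^ 2)) ∧
    -- for the chi-squared divergence the bound is at least as good as Ullrich's bound
    -- `√η(SW) ≤ (2 C² - 1 + √η(HB)) / (2 C²)`, and strictly better if `η(HB) < 1`
    (∀ h : ℝ,
      h = SDPI.eta (fun u : ℝ => (u - 1) ^ 2) (SDPI.gibbs G q β) (SDPI.kernelHB G q β) →
      √((SDPI.comparisonConst G q β - 1) / (SDPI.comparisonConst G q β - h ^ 2)) ≤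
          (2 * (SDPI.comparisonConst G q β) ^ 2 - 1 + √h) /
            (2 * (SDPI.comparisonConst G q β) ^ 2) ∧
        (h < 1 →
          √((SDPI.comparisonConst G q β - 1) / (SDPI.comparisonConst G q β - h ^ 2)) <
            (2 * (SDPI.comparisonConst G q β) ^ 2 - 1 + √h) /
              (2 * (SDPI.comparisonConst G q β) ^ 2))) := by
  have : NeZero q := ⟨by omega⟩
  have hC := SDPI.two_le_comparisonConst (G := G) hq hβ
  have hH := SDPI.isMarkovKernel_kernelHB G q β
  have hpos := SDPI.gibbs_pos G q β
  have hsum := SDPI.sum_gibbs G q β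
  have hHμ := SDPI.push_gibbs_kernelHB G q β
  refine ⟨fun Φ hΦ _ => ?_, ?_⟩
  · exact SDPI.eta_le_of_sandwich_le hΦ (SDPI.isMarkovKernel_kernelSW hβ) hH hpos hsum
      (SDPI.push_gibbs_kernelSW hβ) hHμ (by linarith) (SDPI.kernelHB_kernelSW_kernelHB_le hβ)
  · rintro h rfl
    have hHpos : ∀ y, 0 < SDPI.push (SDPI.gibbs G q β) (SDPI.kernelHB G q β) y := by
      rw [hHμ]; exact hpos
    exact SDPI.sqrt_sub_one_div_le hC
      (SDPI.eta_nonneg SDPI.isGenerating_sq_sub_one hH hpos hsum hHpos)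
      (SDPI.eta_le_one SDPI.isGenerating_sq_sub_one hH hpos hsum hHpos)
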